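/- Let $K$ be a field of characteristic zero. Let $P(\mathrm{sl}_2(K))$ be the Poisson enveloping algebra of $\mathrm{sl}_2(K)$, i.e. the polynomial algebra $K[e,f,h]$ on the standard basis $e,f,h$ of $\mathrm{sl}_2(K)$ with the unique Poisson bracket such that $\{h,e\}=2e$, $\{h,f\}=-2f$, $\{e,f\}=h$, and let $C=\tfrac12h^2+2ef$ be its standard Casimir element. For $\lambda\in K$ let $(C-\lambda)$ denote the ideal of $K[e,f,h]$ generated by $C-\lambda$; it is a Poisson ideal, because $C$ is central for the bracket. Then for every $\lambda\in K$ with $\lambda\neq 0$ the quotient Poisson algebra $P(\mathrm{sl}_2(K))/(C-\lambda)$ is central and simple over $K$: the set of its elements $c$ with $\{c,a\}=0$ for all $a$ is exactly $K$, the algebra is nonzero, and its only ideals $I$ (for the commutative multiplication) with $\{a,x\}\in I$ for all elements $a$ of the algebra and all $x\in I$ are $0$ and the whole algebra. -/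

import Mathlib

open MvPolynomial LieAlgebra.SpecialLinear

/-- A structure of Poisson algebra over `K` on a commutative associative `K`-algebra `A`:
a `K`-bilinear Lie bracket that satisfies the Leibniz identity. -/
structure PoissonStructure (K A : Type*) [CommRing K] [CommRing A] [Algebra K A] where
  /-- the Poisson bracket -/
  bracket : A →ₗ[K] A →ₗ[K] A
  bracket_self : ∀ a, bracket a a = 0
  jacobi : ∀ a b c,
    bracket a (bracket b c) + bracket b (bracket c a) + bracket c (bracket a b) = 0
  leibniz : ∀ a b c, bracket a (b * c) = bracket a b * c + b * bracket a c

namespace PoissonStructure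

variable {K A : Type*} [CommRing K] [CommRing A] [Algebra K A] (P : PoissonStructure K A)

theorem bracket_skew (a b : A) : P.bracket a b = -P.bracket b a := by
  have h := P.bracket_self (a + b)
  simp only [map_add, LinearMap.add_apply, P.bracket_self] at h
  linear_combination h

/-- A Poisson ideal: an ideal for the multiplication and for the bracket. -/
def IsPoissonIdeal (I : Ideal A) : Prop := ∀ a : A, ∀ x ∈ I, P.bracket a x ∈ I

/-- The center for the Poisson bracket: the elements `c` such that `{c, a} = 0` for all `a`. -/
def center : Set A := {c | ∀ a : A, P.bracket c a = 0}

/-- A Poisson algebra is simple if it is nonzero and its only Poisson ideals are `0` and itself. -/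
def IsSimple : Prop := Nontrivial A ∧ ∀ I : Ideal A, P.IsPoissonIdeal I → I = ⊥ ∨ I = ⊤

/-- A Poisson algebra is central over `K` if its center consists of the scalars. -/
def IsCentral : Prop := P.center = Set.range (algebraMap K A)

/-- The ideal generated by a central element is a Poisson ideal. -/
theorem isPoissonIdeal_span_singleton {c : A} (hc : c ∈ P.center) :
    P.IsPoissonIdeal (Ideal.span {c}) := by
  intro a x hx
  obtain ⟨y, rfl⟩ := Ideal.mem_span_singleton'.1 hx
  rw [P.leibniz, P.bracket_skew a c, hc a, neg_zero, mul_zero, add_zero]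
  exact Ideal.mul_mem_left _ _ (Ideal.mem_span_singleton_self c)

theorem bracket_sub_mem {I : Ideal A} (hI : P.IsPoissonIdeal I) {a a' b b' : A}
    (ha : a - a' ∈ I) (hb : b - b' ∈ I) : P.bracket a b - P.bracket a' b' ∈ I := by
  have h1 : P.bracket b (a - a') ∈ I := hI _ _ ha
  have h2 : P.bracket a' (b - b') ∈ I := hI _ _ hb
  have h3 : P.bracket a b - P.bracket a' b' = -P.bracket b (a - a') + P.bracket a' (b - b') := by
    rw [map_sub, map_sub, P.bracket_skew b a, P.bracket_skew b a']
    ring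
  rw [h3]
  exact I.add_mem (I.neg_mem h1) h2

/-- The bracket induced on the quotient by a Poisson ideal, as a function. -/
def quotientBracketFun (I : Ideal A) (hI : P.IsPoissonIdeal I) : A ⧸ I → A ⧸ I → A ⧸ I :=
  Quotient.map₂ (fun a b => P.bracket a b) (fun _ _ ha _ _ hb =>
    (Submodule.quotientRel_def I).2
      (P.bracket_sub_mem hI ((Submodule.quotientRel_def I).1 ha)
        ((Submodule.quotientRel_def I).1 hb)))

theorem quotientBracketFun_mk (I : Ideal A) (hI : P.IsPoissonIdeal I) (a b : A) :
    P.quotientBracketFun I hI (Ideal.Quotient.mk I a) (Ideal.Quotient.mk I b) =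
      Ideal.Quotient.mk I (P.bracket a b) := rfl

/-- The quotient Poisson algebra by a Poisson ideal: `{a + I, b + I} = {a, b} + I`. -/
def quotient (I : Ideal A) (hI : P.IsPoissonIdeal I) : PoissonStructure K (A ⧸ I) where
  bracket := LinearMap.mk₂ K (P.quotientBracketFun I hI)
    (by
      intro x y z
      obtain ⟨a, rfl⟩ := Ideal.Quotient.mk_surjective x
      obtain ⟨b, rfl⟩ := Ideal.Quotient.mk_surjective y
      obtain ⟨c, rfl⟩ := Ideal.Quotient.mk_surjective z
      simp only [← map_add, quotientBracketFun_mk]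
      rw [map_add, LinearMap.add_apply])
    (by
      intro k x y
      obtain ⟨a, rfl⟩ := Ideal.Quotient.mk_surjective x
      obtain ⟨b, rfl⟩ := Ideal.Quotient.mk_surjective y
      have h (c : A) : k • Ideal.Quotient.mk I c = Ideal.Quotient.mk I (k • c) := rfl
      rw [h, quotientBracketFun_mk, quotientBracketFun_mk, h, map_smul, LinearMap.smul_apply])
    (by
      intro x y z
      obtain ⟨a, rfl⟩ := Ideal.Quotient.mk_surjective x
      obtain ⟨b, rfl⟩ := Ideal.Quotient.mk_surjective y
      obtain ⟨c, rfl⟩ := Ideal.Quotient.mk_surjective z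
      simp only [← map_add, quotientBracketFun_mk])
    (by
      intro k x y
      obtain ⟨a, rfl⟩ := Ideal.Quotient.mk_surjective x
      obtain ⟨b, rfl⟩ := Ideal.Quotient.mk_surjective y
      have h (c : A) : k • Ideal.Quotient.mk I c = Ideal.Quotient.mk I (k • c) := rfl
      rw [h, quotientBracketFun_mk, quotientBracketFun_mk, h, map_smul])
  bracket_self := by
    intro x
    obtain ⟨a, rfl⟩ := Ideal.Quotient.mk_surjective x
    simp only [LinearMap.mk₂_apply, quotientBracketFun_mk, P.bracket_self, map_zero]
  jacobi := by
    intro x y z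
    obtain ⟨a, rfl⟩ := Ideal.Quotient.mk_surjective x
    obtain ⟨b, rfl⟩ := Ideal.Quotient.mk_surjective y
    obtain ⟨c, rfl⟩ := Ideal.Quotient.mk_surjective z
    simp only [LinearMap.mk₂_apply, quotientBracketFun_mk, ← map_add, P.jacobi, map_zero]
  leibniz := by
    intro x y z
    obtain ⟨a, rfl⟩ := Ideal.Quotient.mk_surjective x
    obtain ⟨b, rfl⟩ := Ideal.Quotient.mk_surjective y
    obtain ⟨c, rfl⟩ := Ideal.Quotient.mk_surjective z
    simp only [LinearMap.mk₂_apply, quotientBracketFun_mk, ← map_mul, ← map_add, P.leibniz]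

end PoissonStructure

section Enveloping

variable {K L ι : Type*} [CommRing K] [LieRing L] [LieAlgebra K L] (b : Module.Basis ι K L)

/-- The elements of `L` as linear forms in the polynomial algebra on a basis of `L`. -/
noncomputable def linearForm : L →ₗ[K] MvPolynomial ι K := b.constr K X

/-- `f ↦ {f, ·}`, the biderivation of the polynomial algebra on the basis `b` of `L` with
`{X i, X j} = [b i, b j]`. -/
noncomputable def envelopingAd :
    Derivation K (MvPolynomial ι K) (Derivation K (MvPolynomial ι K) (MvPolynomial ι K)) :=
  mkDerivation K fun i => mkDerivation K fun j => linearForm b ⁅b i, b j⁆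

theorem linearForm_basis (i : ι) : linearForm b (b i) = X i := by
  simp [linearForm]

theorem envelopingAd_X_X (i j : ι) : envelopingAd b (X i) (X j) = linearForm b ⁅b i, b j⁆ := by
  simp [envelopingAd]

theorem envelopingAd_skew (p q : MvPolynomial ι K) :
    envelopingAd b p q = -envelopingAd b q p := by
  have hX : ∀ i, envelopingAd b (X i) q = -envelopingAd b q (X i) := by
    intro i
    induction q using MvPolynomial.induction_on with
    | C k => simp
    | add q q' hq hq' => simp [hq, hq', add_comm]
    | mul_X q j hq =>
      simp only [Derivation.leibniz, Derivation.add_apply, Derivation.smul_apply, hq,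
        envelopingAd_X_X, ← lie_skew (b i) (b j), map_neg, smul_eq_mul]
      ring
  induction p using MvPolynomial.induction_on with
  | C k => simp
  | add p p' hp hp' => simp [hp, hp', add_comm]
  | mul_X p i hp =>
    simp only [Derivation.leibniz, Derivation.add_apply, Derivation.smul_apply, hp, hX,
      smul_eq_mul]
    ring

theorem envelopingAd_linearForm (x y : L) :
    envelopingAd b (linearForm b x) (linearForm b y) = linearForm b ⁅x, y⁆ := by
  have h1 : ∀ i y, envelopingAd b (X i) (linearForm b y) = linearForm b ⁅b i, y⁆ := by
    intro i y
    have : (envelopingAd b (X i)).toLinearMap ∘ₗ linearForm b =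
        linearForm b ∘ₗ (LieModule.toEnd K L L (b i) : L →ₗ[K] L) := by
      refine b.ext fun j => ?_
      simp [linearForm_basis, envelopingAd_X_X]
    simpa using congrArg (fun f => f y) this
  have h2 : (envelopingAd b (linearForm b x)).toLinearMap ∘ₗ linearForm b =
      linearForm b ∘ₗ (LieModule.toEnd K L L x : L →ₗ[K] L) := by
    refine b.ext fun j => ?_
    simp only [LinearMap.comp_apply, Derivation.coeFn_coe,
      linearForm_basis, LieModule.toEnd_apply_apply]
    rw [envelopingAd_skew, h1, ← map_neg, lie_skew]
  simpa using congrArg (fun f => f y) h2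

theorem envelopingAd_self (p : MvPolynomial ι K) : envelopingAd b p p = 0 := by
  induction p using MvPolynomial.induction_on with
  | C k => simp
  | add p q hp hq =>
    simp only [map_add, Derivation.add_apply, hp, hq, envelopingAd_skew b q p]
    ring
  | mul_X p i hp =>
    simp only [Derivation.leibniz, Derivation.add_apply, Derivation.smul_apply, hp,
      smul_eq_mul, envelopingAd_X_X, lie_self, map_zero, envelopingAd_skew b (X i) p]
    ring

/-- The Jacobi identity, in the form `ad {p, q} = [ad p, ad q]`. -/
theorem envelopingAd_bracket (p q r : MvPolynomial ι K) :
    envelopingAd b (envelopingAd b p q) r =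
      envelopingAd b p (envelopingAd b q r) - envelopingAd b q (envelopingAd b p r) := by
  have hXX : ∀ i j, envelopingAd b (envelopingAd b (X i) (X j)) =
      ⁅envelopingAd b (X i), envelopingAd b (X j)⁆ := by
    intro i j
    refine derivation_ext fun k => ?_
    rw [Derivation.commutator_apply, ← linearForm_basis b i, ← linearForm_basis b j,
      ← linearForm_basis b k]
    simp only [envelopingAd_linearForm, ← map_sub]
    rw [lie_lie]
  have hX : ∀ i, envelopingAd b (envelopingAd b (X i) q) r =
      envelopingAd b (X i) (envelopingAd b q r) - envelopingAd b q (envelopingAd b (X i) r) := by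
    intro i
    induction q using MvPolynomial.induction_on with
    | C k => simp
    | add q q' hq hq' =>
      simp only [map_add, Derivation.add_apply, hq, hq']
      ring
    | mul_X q j hq =>
      have := congrArg (fun D => D r) (hXX i j)
      simp only [Derivation.commutator_apply] at this
      simp only [Derivation.leibniz, map_add, Derivation.add_apply, Derivation.smul_apply, hq, this,
        smul_eq_mul]
      ring
  induction p using MvPolynomial.induction_on with
  | C k => simp
  | add p p' hp hp' =>
    simp only [map_add, Derivation.add_apply, hp, hp']
    ring
  | mul_X p i hp =>
    simp only [Derivation.leibniz, map_add, Derivation.add_apply, Derivation.smul_apply, hp, hX,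
      smul_eq_mul]
    rw [envelopingAd_skew b p q, envelopingAd_skew b (X i) q]
    ring

/-- The Poisson enveloping algebra of `L`: the polynomial algebra on a basis `b` of `L`, with the
unique Poisson bracket that extends the Lie bracket of `L`. -/
noncomputable def poissonEnveloping : PoissonStructure K (MvPolynomial ι K) where
  bracket := LinearMap.mk₂ K (fun p q => envelopingAd b p q)
    (by simp) (by simp) (by simp) (by simp)
  bracket_self := envelopingAd_self b
  jacobi p q r := by
    simp only [LinearMap.mk₂_apply]
    rw [envelopingAd_skew b r (envelopingAd b p q), envelopingAd_bracket,
      envelopingAd_skew b r p, map_neg]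
    ring
  leibniz p q r := by
    simp only [LinearMap.mk₂_apply, Derivation.leibniz, smul_eq_mul]
    ring

theorem poissonEnveloping_bracket (p q : MvPolynomial ι K) :
    (poissonEnveloping b).bracket p q = envelopingAd b p q := rfl

theorem poissonEnveloping_bracket_linearForm (x y : L) :
    (poissonEnveloping b).bracket (linearForm b x) (linearForm b y) = linearForm b ⁅x, y⁆ :=
  envelopingAd_linearForm b x y

/-- Uniqueness of the bracket of the Poisson enveloping algebra. -/
theorem poissonEnveloping_unique (P : PoissonStructure K (MvPolynomial ι K))
    (hP : ∀ i j, P.bracket (X i) (X j) = linearForm b ⁅b i, b j⁆) :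
    ∀ p q, P.bracket p q = (poissonEnveloping b).bracket p q := by
  have hC : ∀ p k, P.bracket p (C k) = 0 := by
    intro p k
    have h1 := P.leibniz p 1 1
    simp only [mul_one, one_mul] at h1
    rw [← mul_one (C k), C_mul', map_smul, left_eq_add.1 h1, smul_zero]
  have key : ∀ Q : PoissonStructure K (MvPolynomial ι K), ∀ a, (∀ i, P.bracket a (X i) =
      Q.bracket a (X i)) → (∀ k, Q.bracket a (C k) = 0) → ∀ p, P.bracket a p = Q.bracket a p := by
    intro Q a h hQ p
    induction p using MvPolynomial.induction_on with
    | C k => rw [hC, hQ]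
    | add p q hp hq => simp [hp, hq]
    | mul_X p i hp => rw [P.leibniz, Q.leibniz, hp, h]
  have hC' : ∀ p k, (poissonEnveloping b).bracket p (C k) = 0 := by
    intro p k
    simp [poissonEnveloping_bracket]
  have hX : ∀ i q, P.bracket (X i) q = (poissonEnveloping b).bracket (X i) q := fun i q =>
    key _ _ (fun j => by rw [hP, poissonEnveloping_bracket, envelopingAd_X_X]) (hC' _) q
  intro p q
  refine key _ p (fun i => ?_) (hC' _) q
  rw [P.bracket_skew, hX, ← PoissonStructure.bracket_skew]

end Enveloping

section Sl2

variable (K : Type*) [Field K]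

/-- The standard basis element `e = !![0, 1; 0, 0]` of `sl₂(K)`. -/
def sl2E : sl (Fin 2) K := single 0 1 (by decide) 1

/-- The standard basis element `f = !![0, 0; 1, 0]` of `sl₂(K)`. -/
def sl2F : sl (Fin 2) K := single 1 0 (by decide) 1

/-- The standard basis element `h = !![1, 0; 0, -1]` of `sl₂(K)`. -/
def sl2H : sl (Fin 2) K := singleSubSingle 0 1 1

theorem sl2E_val : (sl2E K).val = !![0, 1; 0, 0] := by
  ext i j; fin_cases i <;> fin_cases j <;> simp [sl2E, Matrix.single]

theorem sl2F_val : (sl2F K).val = !![0, 0; 1, 0] := by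
  ext i j; fin_cases i <;> fin_cases j <;> simp [sl2F, Matrix.single]

theorem sl2H_val : (sl2H K).val = !![1, 0; 0, -1] := by
  ext i j; fin_cases i <;> fin_cases j <;> simp [sl2H, Matrix.single]

theorem sl2_lie_e_f : ⁅sl2E K, sl2F K⁆ = sl2H K := by
  apply Subtype.ext
  rw [sl_bracket, sl2E_val, sl2F_val, sl2H_val]
  simp

theorem sl2_lie_h_e : ⁅sl2H K, sl2E K⁆ = (2 : K) • sl2E K := by
  apply Subtype.ext
  change (sl2H K).val * (sl2E K).val - (sl2E K).val * (sl2H K).val = (2 : K) • (sl2E K).val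
  rw [sl2E_val, sl2H_val]
  simp [one_add_one_eq_two]

theorem sl2_lie_h_f : ⁅sl2H K, sl2F K⁆ = -((2 : K) • sl2F K) := by
  apply Subtype.ext
  change (sl2H K).val * (sl2F K).val - (sl2F K).val * (sl2H K).val = -((2 : K) • (sl2F K).val)
  rw [sl2F_val, sl2H_val]
  ext i j
  fin_cases i <;> fin_cases j <;> simp
  ring

theorem sl2_combination (k : Fin 3 → K) :
    (∑ i, k i • ![sl2E K, sl2F K, sl2H K] i : sl (Fin 2) K).val =
      !![k 2, k 0; k 1, -k 2] := by
  simp [Fin.sum_univ_three, sl2E_val, sl2F_val, sl2H_val]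

/-- The standard basis `e, f, h` of `sl₂(K)`, in this order. -/
noncomputable def sl2Basis : Module.Basis (Fin 3) K (sl (Fin 2) K) :=
  Module.Basis.mk (v := ![sl2E K, sl2F K, sl2H K])
    (by
      rw [Fintype.linearIndependent_iff]
      intro k hk
      have h := sl2_combination K k
      rw [hk] at h
      have h0 := congrFun (congrFun h 0) 1
      have h1 := congrFun (congrFun h 1) 0
      have h2 := congrFun (congrFun h 0) 0
      intro i
      fin_cases i <;> simp_all)
    (by
      intro A _
      rw [Submodule.mem_span_range_iff_exists_fun]
      refine ⟨![A.val 0 1, A.val 1 0, A.val 0 0], Subtype.ext ?_⟩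
      rw [sl2_combination]
      have hA : A.val 0 0 + A.val 1 1 = 0 := by
        have := A.2
        simpa [sl, Matrix.trace_fin_two] using this
      ext i j
      fin_cases i <;> fin_cases j <;> simp
      linear_combination -hA)

/-- The Poisson enveloping algebra of `sl₂(K)`, on `K[e, f, h]` with `e = X 0`, `f = X 1`,
`h = X 2`. -/
noncomputable def poissonSl2 : PoissonStructure K (MvPolynomial (Fin 3) K) :=
  poissonEnveloping (sl2Basis K)

/-- The standard Casimir element `½ h² + 2 e f` of the Poisson enveloping algebra of `sl₂(K)`. -/
noncomputable def casimir : MvPolynomial (Fin 3) K :=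
  C (1 / 2) * X 2 ^ 2 + 2 * X 0 * X 1

theorem linearForm_sl2E : linearForm (sl2Basis K) (sl2E K) = X 0 := by
  rw [← linearForm_basis (sl2Basis K) 0]; simp [sl2Basis]

theorem linearForm_sl2F : linearForm (sl2Basis K) (sl2F K) = X 1 := by
  rw [← linearForm_basis (sl2Basis K) 1]; simp [sl2Basis]

theorem linearForm_sl2H : linearForm (sl2Basis K) (sl2H K) = X 2 := by
  rw [← linearForm_basis (sl2Basis K) 2]; simp [sl2Basis]

theorem poissonSl2_e_f : (poissonSl2 K).bracket (X 0) (X 1) = X 2 := by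
  rw [← linearForm_sl2E, ← linearForm_sl2F, ← linearForm_sl2H, poissonSl2,
    poissonEnveloping_bracket_linearForm, sl2_lie_e_f]

theorem poissonSl2_h_e : (poissonSl2 K).bracket (X 2) (X 0) = 2 * X 0 := by
  rw [← linearForm_sl2E, ← linearForm_sl2H, poissonSl2,
    poissonEnveloping_bracket_linearForm, sl2_lie_h_e, map_smul, smul_eq_C_mul, map_ofNat]

theorem poissonSl2_h_f : (poissonSl2 K).bracket (X 2) (X 1) = -(2 * X 1) := by
  rw [← linearForm_sl2F, ← linearForm_sl2H, poissonSl2,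
    poissonEnveloping_bracket_linearForm, sl2_lie_h_f, map_neg, map_smul, smul_eq_C_mul, map_ofNat]

variable [CharZero K]

set_option linter.unusedSimpArgs false in
theorem casimir_sub_mem_center (k : K) : casimir K - C k ∈ (poissonSl2 K).center := by
  have e_f := poissonSl2_e_f K
  have h_e := poissonSl2_h_e K
  have h_f := poissonSl2_h_f K
  have f_e := (poissonSl2 K).bracket_skew (X 1) (X 0)
  have e_h := (poissonSl2 K).bracket_skew (X 0) (X 2)
  have f_h := (poissonSl2 K).bracket_skew (X 1) (X 2)
  have e_e := (poissonSl2 K).bracket_self (X 0)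
  have f_f := (poissonSl2 K).bracket_self (X 1)
  have h_h := (poissonSl2 K).bracket_self (X 2)
  have half : (C 2⁻¹ : MvPolynomial (Fin 3) K) * 2 = 1 := by
    rw [← map_ofNat (C : K →+* MvPolynomial (Fin 3) K) 2, ← map_mul]
    simp
  rw [e_f] at f_e
  rw [h_e] at e_h
  rw [h_f] at f_h
  simp only [poissonSl2, poissonEnveloping_bracket] at *
  have key : envelopingAd (sl2Basis K) (casimir K - C k) = 0 := by
    have h2 : envelopingAd (sl2Basis K) (2 : MvPolynomial (Fin 3) K) = 0 := by
      rw [← map_ofNat (C : K →+* MvPolynomial (Fin 3) K) 2, derivation_C]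
    refine derivation_ext fun i => ?_
    simp only [casimir, map_sub, map_add, Derivation.leibniz, Derivation.leibniz_pow,
      derivation_C, Derivation.add_apply, Derivation.smul_apply,
      Derivation.zero_apply, h2, smul_zero, sub_zero, add_zero]
    fin_cases i
    · simp [e_f, h_e, h_f, f_e, e_h, f_h, e_e, f_f, h_h]
      linear_combination (2 * X 0 * X 2) * half
    · simp [e_f, h_e, h_f, f_e, e_h, f_h, e_e, f_f, h_h]
      linear_combination (-2 * X 1 * X 2) * half
    · simp [e_f, h_e, h_f, f_e, e_h, f_h, e_e, f_f, h_h]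
      ring
  intro a
  rw [poissonEnveloping_bracket, key, Derivation.zero_apply]

/-- The ideal generated by `C - λ` is a Poisson ideal. -/
theorem isPoissonIdeal_casimir_sub (k : K) :
    (poissonSl2 K).IsPoissonIdeal (Ideal.span {casimir K - C k}) :=
  (poissonSl2 K).isPoissonIdeal_span_singleton (casimir_sub_mem_center K k)

/-- The quotient Poisson algebra `P(sl₂(K)) / (C - λ)`. -/
noncomputable def poissonSl2Quotient (k : K) :
    PoissonStructure K (MvPolynomial (Fin 3) K ⧸ Ideal.span {casimir K - C k}) :=
  (poissonSl2 K).quotient (Ideal.span {casimir K - C k}) (isPoissonIdeal_casimir_sub K k)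

end Sl2

/-! Write A for the quotient. On the level set C = λ the relation 2ef = λ - h²/2 determines f once e
is inverted, so A embeds in K(e, h) and every x in A satisfies e^N x = p(e, h) for some polynomial p
(`exists_X_zero_pow_mul_eq_aevalAeval`). On such polynomials {e, ·} is -2e d/dh, and on polynomials
in e alone {h, ·} is 2e d/de.

Simplicity: a nonzero Poisson ideal contains some p(e, h) with p ≠ 0. Bracketing with e removes h,
then the Euler operator e d/de isolates a power of e. Bracketing with f and using C = λ ≠ 0 lowers
that power down to 1 (`eq_top_of_pow_mem`).

Centrality: if c is central and e^N c = p(e, h), then {e, ·} shows that p is free of h, and {h, ·}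
shows that it is an eigenvector of the Euler operator of weight N. So e^N c = k e^N, and e is
cancelled. Here p must be determined by its value in A, which is `aevalAeval_mk_injective`. -/

namespace PoissonStructure

variable {K A : Type*} [CommRing K] [CommRing A] [Algebra K A] (P : PoissonStructure K A)

/-- The derivation `{a, ·}`. -/
def ad (a : A) : Derivation K A A :=
  Derivation.mk' (P.bracket a) fun b c => by
    rw [P.leibniz, smul_eq_mul, smul_eq_mul]; ring

theorem ad_apply (a b : A) : P.ad a b = P.bracket a b := rfl

theorem bracket_algebraMap (a : A) (k : K) : P.bracket a (algebraMap K A k) = 0 :=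
  (P.ad a).map_algebraMap k

theorem algebraMap_mem_center (k : K) : algebraMap K A k ∈ P.center := fun a => by
  rw [P.bracket_skew, P.bracket_algebraMap, neg_zero]

end PoissonStructure

/-! ### Chain rules for derivations, and the Euler operator. -/

section Derivations

variable {K A : Type*} [CommRing K] [CommRing A] [Algebra K A] (D : Derivation K A A)

theorem Derivation.map_polynomial_aeval (e : A) (q : Polynomial K) :
    D (Polynomial.aeval e q) = Polynomial.aeval e (Polynomial.derivative q) * D e := by
  induction q using Polynomial.induction_on' with
  | add p q hp hq => simp only [map_add, hp, hq, add_mul]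
  | monomial n k =>
    simp only [Polynomial.aeval_monomial, Polynomial.derivative_monomial, Derivation.leibniz,
      Derivation.leibniz_pow, Derivation.map_algebraMap, smul_eq_mul, nsmul_eq_mul, map_mul,
      _root_.map_natCast]
    ring

theorem Derivation.map_aevalAeval_of_eq_zero {e : A} (he : D e = 0) (h : A)
    (p : Polynomial (Polynomial K)) :
    D (Polynomial.aevalAeval e h p) =
      Polynomial.aevalAeval e h (Polynomial.derivative p) * D h := by
  induction p using Polynomial.induction_on' with
  | add p q hp hq => simp only [map_add, hp, hq, add_mul]
  | monomial n q =>
    simp only [← Polynomial.C_mul_X_pow_eq_monomial, Polynomial.derivative_C_mul_X_pow, map_mul,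
      map_pow, Polynomial.aevalAeval_C, Polynomial.aevalAeval_Y, Derivation.leibniz,
      Derivation.leibniz_pow, Derivation.map_polynomial_aeval, he, smul_eq_mul, nsmul_eq_mul,
      _root_.map_natCast]
    ring

end Derivations

/-- Eigenvectors of the Euler operator `X d/dX` are monomials. -/
theorem Polynomial.eq_C_mul_X_pow_of_X_mul_derivative {K : Type*} [Field K] [CharZero K]
    {q : Polynomial K} {d : ℕ} (hq : X * derivative q = C (d : K) * q) :
    q = C (q.coeff d) * X ^ d := by
  ext k
  rw [coeff_C_mul_X_pow]
  split_ifs with hk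
  · rw [hk]
  · have h := congrArg (fun r => coeff r k) hq
    simp only [coeff_C_mul] at h
    -- The coefficients at k give (k - d) q_k = 0; the constant term is separate because X * q' has
    -- none.
    cases k with
    | zero =>
      have hd : (d : K) ≠ 0 := Nat.cast_ne_zero.2 (Ne.symm hk)
      simpa [hd] using h.symm
    | succ k =>
      rw [coeff_X_mul, coeff_derivative] at h
      have hd : ((k : K) + 1 - d) ≠ 0 := by
        rw [sub_ne_zero]
        exact_mod_cast hk
      exact (mul_eq_zero.1 (show ((k : K) + 1 - d) * q.coeff (k + 1) = 0 by
        linear_combination h)).resolve_left hd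

/-! ### Poisson ideals and center of an algebra with elements e, f, h as above. -/

section Sl2Triple

variable {K A : Type*} [Field K] [CommRing A] [Algebra K A]
  {P : PoissonStructure K A} {e f h : A}

theorem bracket_aevalAeval (h_e : P.bracket h e = 2 * e) (p : Polynomial (Polynomial K)) :
    P.bracket e (Polynomial.aevalAeval e h p) =
      Polynomial.aevalAeval e h
        (Polynomial.C (-2 * Polynomial.X) * Polynomial.derivative p) := by
  have := (P.ad e).map_aevalAeval_of_eq_zero (P.bracket_self e) h p
  rw [P.ad_apply, P.ad_apply, P.bracket_skew e h, h_e] at this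
  rw [this, map_mul, Polynomial.aevalAeval_C]
  simp only [map_mul, map_neg, map_ofNat, Polynomial.aeval_X]
  ring

theorem bracket_aeval (h_e : P.bracket h e = 2 * e) (q : Polynomial K) :
    P.bracket h (Polynomial.aeval e q) =
      2 * Polynomial.aeval e (Polynomial.X * Polynomial.derivative q) := by
  have := (P.ad h).map_polynomial_aeval e q
  rw [P.ad_apply, P.ad_apply, h_e] at this
  rw [this, map_mul, Polynomial.aeval_X]
  ring

variable [CharZero K]

/-- Bracketing with e multiplies dp/dh by -2e. This lowers the degree in h by at least one and, in
characteristic zero, keeps p nonzero as long as h occurs in it. -/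
theorem exists_aeval_mem_of_aevalAeval_mem (h_e : P.bracket h e = 2 * e) {I : Ideal A}
    (hI : P.IsPoissonIdeal I) (p : Polynomial (Polynomial K)) (hp : p ≠ 0)
    (hpI : Polynomial.aevalAeval e h p ∈ I) :
    ∃ q : Polynomial K, q ≠ 0 ∧ Polynomial.aeval e q ∈ I := by
  induction hd : p.natDegree using Nat.strong_induction_on generalizing p with
  | _ d ih =>
    rcases Nat.eq_zero_or_pos d with rfl | hpos
    · rw [Polynomial.eq_C_of_natDegree_eq_zero hd] at hp hpI
      rw [Polynomial.aevalAeval_C] at hpI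
      exact ⟨_, fun h0 => hp (by rw [h0, map_zero]), hpI⟩
    · have hp' : Polynomial.derivative p ≠ 0 := fun h0 =>
        (hd ▸ hpos).ne' (Polynomial.derivative_eq_zero.1 h0)
      have hX : Polynomial.C (-2 * Polynomial.X : Polynomial K) ≠ 0 :=
        Polynomial.C_ne_zero.2 (mul_ne_zero (neg_ne_zero.2 two_ne_zero) Polynomial.X_ne_zero)
      refine ih _ ?_ _ (mul_ne_zero hX hp') (bracket_aevalAeval h_e p ▸ hI e _ hpI) rfl
      rw [Polynomial.natDegree_mul hX hp', Polynomial.natDegree_C, zero_add, ← hd]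
      exact Polynomial.natDegree_derivative_lt (hd ▸ hpos).ne'

/-- With d the degree of q, the ideal also contains the value of X q' - d q, in which the leading
term cancels. Either this polynomial is nonzero of smaller degree, or q is already a monomial. -/
theorem exists_pow_mem_of_aeval_mem (h_e : P.bracket h e = 2 * e) {I : Ideal A}
    (hI : P.IsPoissonIdeal I) (q : Polynomial K) (hq : q ≠ 0)
    (hqI : Polynomial.aeval e q ∈ I) : ∃ n : ℕ, e ^ n ∈ I := by
  induction hd : q.natDegree using Nat.strong_induction_on generalizing q with
  | _ d ih =>
    have h2 : algebraMap K A (2⁻¹) * 2 = 1 := by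
      rw [← map_ofNat (algebraMap K A) 2, ← map_mul, inv_mul_cancel₀ two_ne_zero, map_one]
    have hrI : Polynomial.aeval e
        (Polynomial.X * Polynomial.derivative q - Polynomial.C (d : K) * q) ∈ I := by
      have h1 := I.mul_mem_left (algebraMap K A (2⁻¹)) (hI h _ hqI)
      rw [bracket_aeval h_e, ← mul_assoc, h2, one_mul] at h1
      rw [map_sub, map_mul _ (Polynomial.C _)]
      exact I.sub_mem h1 (I.mul_mem_left _ hqI)
    by_cases hr : Polynomial.X * Polynomial.derivative q - Polynomial.C (d : K) * q = 0
    · have hmon := Polynomial.eq_C_mul_X_pow_of_X_mul_derivative (sub_eq_zero.1 hr)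
      have hc : q.coeff d ≠ 0 := by
        rw [← hd]; exact Polynomial.leadingCoeff_ne_zero.2 hq
      rw [hmon] at hqI
      refine ⟨d, ?_⟩
      have h1 := I.mul_mem_left (algebraMap K A (q.coeff d)⁻¹) hqI
      rwa [map_mul, map_pow, Polynomial.aeval_C, Polynomial.aeval_X, ← mul_assoc, ← map_mul,
        inv_mul_cancel₀ hc, map_one, one_mul] at h1
    · refine ih _ ?_ _ hr hrI rfl
      have hle : (Polynomial.X * Polynomial.derivative q -
          Polynomial.C (d : K) * q).natDegree ≤ d := by
        refine Polynomial.natDegree_le_iff_coeff_eq_zero.2 fun k hk => ?_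
        have hk0 : q.coeff k = 0 := Polynomial.coeff_eq_zero_of_natDegree_lt (hd ▸ hk)
        obtain ⟨k, rfl⟩ := Nat.exists_eq_add_one_of_ne_zero (Nat.ne_of_gt (Nat.zero_lt_of_lt hk))
        simp [Polynomial.coeff_X_mul, Polynomial.coeff_derivative, hk0]
      refine lt_of_le_of_ne hle fun heq => hr ?_
      rw [← Polynomial.leadingCoeff_eq_zero, Polynomial.leadingCoeff, heq]
      cases d with
      | zero => simp
      | succ d =>
        simp only [Polynomial.coeff_sub, Polynomial.coeff_X_mul, Polynomial.coeff_derivative,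
          Polynomial.coeff_C_mul]
        push_cast
        ring

/-- On a nonzero level set of the Casimir element, a Poisson ideal that contains a power of `e` is
the whole algebra. -/
theorem eq_top_of_pow_mem (e_f : P.bracket e f = h) {lam : K} (hlam : lam ≠ 0)
    (hC : algebraMap K A (1 / 2) * h ^ 2 + 2 * e * f = algebraMap K A lam) {I : Ideal A}
    (hI : P.IsPoissonIdeal I) (n : ℕ) (hn : e ^ n ∈ I) : I = ⊤ := by
  induction n with
  | zero => exact (Ideal.eq_top_iff_one I).2 (by simpa using hn)
  | succ n ih =>
    apply ih
    -- This element is -{f, e^(n+1)}.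
    have h1 : ((n : A) + 1) * (e ^ n * h) ∈ I := by
      have h0 := (P.ad f).leibniz_pow e (n + 1)
      rw [P.ad_apply, P.ad_apply, P.bracket_skew f e, e_f] at h0
      have h2 := I.neg_mem (hI f _ hn)
      rw [h0] at h2
      convert h2 using 1
      simp only [nsmul_eq_mul, smul_eq_mul, Nat.add_sub_cancel]
      push_cast
      ring
    have hn1 : algebraMap K A ((n : K) + 1)⁻¹ * ((n : A) + 1) = 1 := by
      rw [← map_natCast (algebraMap K A) n, ← map_one (algebraMap K A), ← map_add, ← map_mul,
        inv_mul_cancel₀ (Nat.cast_add_one_ne_zero n)]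
    have hl : algebraMap K A lam⁻¹ * algebraMap K A lam = 1 := by
      rw [← map_mul, inv_mul_cancel₀ hlam, map_one]
    have h3 : e ^ n * h ∈ I := by
      have := I.mul_mem_left (algebraMap K A ((n : K) + 1)⁻¹) h1
      rwa [← mul_assoc, hn1, one_mul] at this
    -- The sum (h/2)(e^n h) + (2f) e^(n+1) equals e^n C = λ e^n, so dividing by λ gives e^n.
    have h4 := I.mul_mem_left (algebraMap K A lam⁻¹)
      (I.add_mem (I.mul_mem_left (algebraMap K A (1 / 2) * h) h3) (I.mul_mem_left (2 * f) hn))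
    convert h4 using 1
    linear_combination (-e ^ n) * hl - algebraMap K A lam⁻¹ * e ^ n * hC

theorem eq_bot_or_eq_top_of_isPoissonIdeal (e_f : P.bracket e f = h)
    (h_e : P.bracket h e = 2 * e) {lam : K} (hlam : lam ≠ 0)
    (hC : algebraMap K A (1 / 2) * h ^ 2 + 2 * e * f = algebraMap K A lam)
    (he : ∀ x, e * x = 0 → x = 0)
    (hgen : ∀ x, ∃ (N : ℕ) (p : Polynomial (Polynomial K)),
      e ^ N * x = Polynomial.aevalAeval e h p) {I : Ideal A}
    (hI : P.IsPoissonIdeal I) : I = ⊥ ∨ I = ⊤ := by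
  refine or_iff_not_imp_left.2 fun hbot => ?_
  obtain ⟨x, hx, hx0⟩ := Submodule.exists_mem_ne_zero_of_ne_bot hbot
  obtain ⟨N, p, hp⟩ := hgen x
  have hp0 : p ≠ 0 := by
    rintro rfl
    rw [map_zero] at hp
    exact hx0 (((isLeftRegular_of_non_zero_divisor e he).pow N) (by simpa using hp))
  obtain ⟨q, hq, hqI⟩ :=
    exists_aeval_mem_of_aevalAeval_mem h_e hI p hp0 (hp ▸ I.mul_mem_left _ hx)
  obtain ⟨n, hn⟩ := exists_pow_mem_of_aeval_mem h_e hI q hq hqI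
  exact eq_top_of_pow_mem e_f hlam hC hI n hn

theorem isCentral_of_injective_aevalAeval (h_e : P.bracket h e = 2 * e)
    (he : ∀ x, e * x = 0 → x = 0)
    (hgen : ∀ x, ∃ (N : ℕ) (p : Polynomial (Polynomial K)),
      e ^ N * x = Polynomial.aevalAeval e h p)
    (hinj : Function.Injective (Polynomial.aevalAeval (R := K) e h)) : P.IsCentral := by
  refine Set.Subset.antisymm (fun c hc => ?_) ?_
  · have hc' : ∀ a, P.bracket a c = 0 := fun a => by rw [P.bracket_skew, hc a, neg_zero]
    have hreg : ∀ N, IsLeftRegular (e ^ N) := fun N =>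
      (isLeftRegular_of_non_zero_divisor e he).pow N
    obtain ⟨N, p, hp⟩ := hgen c
    have hX : Polynomial.C (-2 * Polynomial.X : Polynomial K) ≠ 0 :=
      Polynomial.C_ne_zero.2 (mul_ne_zero (neg_ne_zero.2 two_ne_zero) Polynomial.X_ne_zero)
    -- Both e^N and c commute with e, so {e, p(e, h)} = 0; injectivity turns this into -2X p' = 0.
    have hp' : Polynomial.derivative p = 0 := by
      refine (mul_eq_zero.1 (hinj ?_)).resolve_left hX
      rw [← bracket_aevalAeval h_e, ← hp, P.leibniz, hc', mul_zero, add_zero, map_zero,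
        ← P.ad_apply, Derivation.leibniz_pow, P.ad_apply, P.bracket_self]
      simp
    obtain ⟨q, rfl⟩ : ∃ q, p = Polynomial.C q :=
      ⟨_, Polynomial.eq_C_of_natDegree_eq_zero
        (Polynomial.derivative_eq_zero.1 hp')⟩
    rw [Polynomial.aevalAeval_C] at hp
    have hinj' : Function.Injective (Polynomial.aeval (R := K) e) := fun a b hab =>
      Polynomial.C_injective (hinj (by simpa only [Polynomial.aevalAeval_C] using hab))
    -- Since c is central, {h, e^N c} = {h, e^N} c = 2N e^N c.
    have hq : Polynomial.X * Polynomial.derivative q = Polynomial.C (N : K) * q := by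
      refine mul_left_cancel₀ (two_ne_zero' (Polynomial K)) (hinj' ?_)
      rw [map_mul, map_ofNat, ← bracket_aeval h_e, ← hp, P.leibniz, hc', mul_zero, add_zero]
      have := bracket_aeval (P := P) h_e (Polynomial.X ^ N : Polynomial K)
      simp only [map_pow, Polynomial.aeval_X] at this
      rw [this]
      simp only [map_mul, map_ofNat, Polynomial.aeval_X, ← hp, map_natCast,
        Polynomial.derivative_X_pow, map_pow]
      -- For N = 0 the exponent N - 1 truncates, but the factor N vanishes.
      cases N with
      | zero => simp
      | succ N =>
        simp only [Nat.add_sub_cancel, pow_succ]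
        ring
    rw [Polynomial.eq_C_mul_X_pow_of_X_mul_derivative hq, map_mul, map_pow, Polynomial.aeval_C,
      Polynomial.aeval_X] at hp
    exact ⟨q.coeff N, ((hreg N) (hp.trans (mul_comm _ _))).symm⟩
  · rintro _ ⟨k, rfl⟩
    exact P.algebraMap_mem_center k

end Sl2Triple

/-! ### The coordinate ring of the level set C = λ. -/

section CasimirQuotient

variable (K : Type*) [Field K] (lam : K)

theorem mk_casimir_eq_algebraMap :
    algebraMap K (MvPolynomial (Fin 3) K ⧸ Ideal.span {casimir K - C lam}) (1 / 2) *
        Ideal.Quotient.mk _ (X 2) ^ 2 +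
      2 * Ideal.Quotient.mk _ (X 0) * Ideal.Quotient.mk _ (X 1) = algebraMap K _ lam := by
  have h0 : Ideal.Quotient.mk (Ideal.span {casimir K - C lam}) (casimir K - C lam) = 0 :=
    Ideal.Quotient.eq_zero_iff_mem.2 (Ideal.mem_span_singleton_self _)
  rw [map_sub, sub_eq_zero] at h0
  rw [casimir, map_add, map_mul, map_mul, map_mul, map_pow, map_ofNat] at h0
  exact h0

variable {K lam}

/-- At the origin X 0 vanishes, while C - λ takes the value -λ. -/
theorem not_X_zero_dvd_casimir_sub (hlam : lam ≠ 0) : ¬ (X 0 ∣ casimir K - C lam) := by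
  rintro ⟨y, hy⟩
  have := congrArg (MvPolynomial.eval (0 : Fin 3 → K)) hy
  simp [casimir] at this
  exact hlam this

/-- If e x = (C - λ) y in the polynomial ring, the prime e divides y because it does not divide C -
λ; cancelling e shows that C - λ divides x. -/
theorem eq_zero_of_mk_X_zero_mul (hlam : lam ≠ 0)
    (x : MvPolynomial (Fin 3) K ⧸ Ideal.span {casimir K - C lam})
    (hx : Ideal.Quotient.mk _ (X 0) * x = 0) : x = 0 := by
  obtain ⟨x, rfl⟩ := Ideal.Quotient.mk_surjective x
  rw [← map_mul, Ideal.Quotient.eq_zero_iff_mem, Ideal.mem_span_singleton] at hx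
  rw [Ideal.Quotient.eq_zero_iff_mem, Ideal.mem_span_singleton]
  obtain ⟨y, hy⟩ := hx
  have hX : Prime (X 0 : MvPolynomial (Fin 3) K) := MvPolynomial.X_prime
  obtain ⟨z, rfl⟩ := (hX.dvd_or_dvd ⟨x, hy.symm⟩).resolve_left (not_X_zero_dvd_casimir_sub hlam)
  exact ⟨z, mul_left_cancel₀ hX.ne_zero (by rw [hy]; ring)⟩

variable [CharZero K]

theorem exists_X_zero_pow_mul_eq_aevalAeval
    (x : MvPolynomial (Fin 3) K ⧸ Ideal.span {casimir K - C lam}) :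
    ∃ (N : ℕ) (p : Polynomial (Polynomial K)), Ideal.Quotient.mk _ (X 0) ^ N * x =
      Polynomial.aevalAeval (Ideal.Quotient.mk _ (X 0)) (Ideal.Quotient.mk _ (X 2)) p := by
  obtain ⟨x, rfl⟩ := Ideal.Quotient.mk_surjective x
  have hC := mk_casimir_eq_algebraMap K lam
  induction x using MvPolynomial.induction_on with
  | C k =>
    refine ⟨0, Polynomial.C (Polynomial.C k), ?_⟩
    rw [Polynomial.aevalAeval_C, Polynomial.aeval_C, pow_zero, one_mul]
    rfl
  | add a b ha hb =>
    obtain ⟨N, p, hp⟩ := ha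
    obtain ⟨M, q, hq⟩ := hb
    refine ⟨N + M, Polynomial.C Polynomial.X ^ M * p + Polynomial.C Polynomial.X ^ N * q, ?_⟩
    simp only [map_add, map_mul, map_pow, Polynomial.aevalAeval_C, Polynomial.aeval_X, ← hp, ← hq]
    ring
  | mul_X a i ha =>
    obtain ⟨N, p, hp⟩ := ha
    fin_cases i
    · refine ⟨N, Polynomial.C Polynomial.X * p, ?_⟩
      simp only [map_mul, Polynomial.aevalAeval_C, Polynomial.aeval_X, ← hp]
      simp only [Fin.zero_eta]
      ring
    -- One more factor e absorbs f, through ef = (λ - h²/2)/2.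
    · refine ⟨N + 1, Polynomial.C (Polynomial.C 2⁻¹) * (Polynomial.C (Polynomial.C lam) -
        Polynomial.C (Polynomial.C (1 / 2)) * Polynomial.X ^ 2) * p, ?_⟩
      have h2 : algebraMap K (MvPolynomial (Fin 3) K ⧸ Ideal.span {casimir K - C lam}) 2⁻¹ * 2
          = 1 := by
        rw [← map_ofNat (algebraMap K (MvPolynomial (Fin 3) K ⧸ Ideal.span {casimir K - C lam})) 2,
          ← map_mul, inv_mul_cancel₀ two_ne_zero, map_one]
      simp only [map_mul, map_sub, map_pow, Polynomial.aevalAeval_C, Polynomial.aevalAeval_Y,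
        Polynomial.aeval_C, ← hp, ← hC]
      simp only [Fin.mk_one]
      linear_combination (-(Ideal.Quotient.mk _ (X 0)) ^ (N + 1) * Ideal.Quotient.mk _ a *
        Ideal.Quotient.mk _ (X 1)) * h2
    · refine ⟨N, Polynomial.X * p, ?_⟩
      simp only [map_mul, Polynomial.aevalAeval_Y, ← hp]
      simp only [Fin.reduceFinMk]
      ring

/-- The coordinate ring of the level set of the Casimir element maps to the rational functions in
`e` and `h`. -/
theorem aevalAeval_mk_injective : Function.Injective
    (Polynomial.aevalAeval (R := K)
      (Ideal.Quotient.mk (Ideal.span {casimir K - C lam}) (X 0))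
      (Ideal.Quotient.mk (Ideal.span {casimir K - C lam}) (X 2))) := by
  let F := FractionRing (Polynomial (Polynomial K))
  let ι : Polynomial (Polynomial K) →ₐ[K] F := IsScalarTower.toAlgHom K _ F
  have hι : Function.Injective ι := IsFractionRing.injective _ F
  let e : F := ι (Polynomial.C Polynomial.X)
  let h : F := ι Polynomial.X
  have he : e ≠ 0 := (map_ne_zero_iff ι hι).2 (Polynomial.C_ne_zero.2 Polynomial.X_ne_zero)
  have h2 : algebraMap K F 2 ≠ 0 := (map_ne_zero _).2 two_ne_zero
  -- The solution of h²/2 + 2ef = λ for f, so that evaluation at (e, f, h) kills C - λ and factors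
  -- through the quotient. The resulting map `G` sends p(e, h) back to p, whence injectivity.
  let f : F := (algebraMap K F lam - algebraMap K F (1 / 2) * h ^ 2) / (algebraMap K F 2 * e)
  let g : MvPolynomial (Fin 3) K →ₐ[K] F := MvPolynomial.aeval ![e, f, h]
  have hg : ∀ a ∈ Ideal.span {casimir K - C lam}, g a = 0 := by
    intro a ha
    obtain ⟨y, rfl⟩ := Ideal.mem_span_singleton'.1 ha
    have hf : algebraMap K F 2 * e * f = algebraMap K F lam - algebraMap K F (1 / 2) * h ^ 2 :=
      mul_div_cancel₀ _ (mul_ne_zero h2 he)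
    rw [map_ofNat] at hf
    have : g (casimir K - C lam) = 0 := by
      simp only [g, casimir, map_sub, map_add, map_mul, map_pow, map_ofNat, MvPolynomial.aeval_X,
        MvPolynomial.algHom_C]
      change algebraMap K F (1 / 2) * h ^ 2 + 2 * e * f - algebraMap K F lam = 0
      linear_combination hf
    rw [map_mul, this, mul_zero]
  let G : (MvPolynomial (Fin 3) K ⧸ Ideal.span {casimir K - C lam}) →ₐ[K] F :=
    Ideal.Quotient.liftₐ _ g hg
  have hcomp : ∀ p, G (Polynomial.aevalAeval (Ideal.Quotient.mk _ (X 0))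
      (Ideal.Quotient.mk _ (X 2)) p) = ι p := by
    intro p
    induction p using Polynomial.induction_on' with
    | add p q hp hq => simp only [map_add, hp, hq]
    | monomial n q =>
      have hX2 : G (Ideal.Quotient.mk _ (X 2)) = h := by
        change g (X 2) = h
        simp [g]
      have hX0 : G (Ideal.Quotient.mk _ (X 0)) = e := by
        change g (X 0) = e
        simp [g]
      have hq : Polynomial.aeval e q = ι (Polynomial.C q) := by
        have : Polynomial.aeval e = ι.comp (Polynomial.CAlgHom (R := K)) :=
          Polynomial.algHom_ext (by simp [e])
        rw [this]; rfl
      rw [← Polynomial.C_mul_X_pow_eq_monomial, map_mul, map_pow, Polynomial.aevalAeval_C,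
        Polynomial.aevalAeval_Y, map_mul, map_pow, hX2, ← Polynomial.aeval_algHom_apply, hX0, hq,
        map_mul, map_pow]
  exact fun a b hab => hι (by rw [← hcomp, hab, hcomp])

theorem nontrivial_casimir_quotient (lam : K) :
    Nontrivial (MvPolynomial (Fin 3) K ⧸ Ideal.span {casimir K - C lam}) :=
  aevalAeval_mk_injective.nontrivial

end CasimirQuotient

theorem corollary1 (K : Type*) [Field K] [CharZero K] (lam : K) (hlam : lam ≠ 0) :
    (poissonSl2Quotient K lam).IsCentral ∧ (poissonSl2Quotient K lam).IsSimple := by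
  -- The bracket of two classes is by definition the class of the bracket, so the relations descend
  -- by `congrArg`.
  have e_f : (poissonSl2Quotient K lam).bracket (Ideal.Quotient.mk _ (X 0))
      (Ideal.Quotient.mk _ (X 1)) = Ideal.Quotient.mk _ (X 2) :=
    congrArg (Ideal.Quotient.mk _) (poissonSl2_e_f K)
  have h_e : (poissonSl2Quotient K lam).bracket (Ideal.Quotient.mk _ (X 2))
      (Ideal.Quotient.mk _ (X 0)) = 2 * Ideal.Quotient.mk _ (X 0) := by
    refine (congrArg (Ideal.Quotient.mk _) (poissonSl2_h_e K)).trans ?_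
    rw [map_mul, map_ofNat]
  exact ⟨isCentral_of_injective_aevalAeval h_e (eq_zero_of_mk_X_zero_mul hlam)
      exists_X_zero_pow_mul_eq_aevalAeval aevalAeval_mk_injective,
    nontrivial_casimir_quotient lam, fun I hI =>
      eq_bot_or_eq_top_of_isPoissonIdeal e_f h_e hlam
        (mk_casimir_eq_algebraMap K lam) (eq_zero_of_mk_X_zero_mul hlam)
        exists_X_zero_pow_mul_eq_aevalAeval hI⟩
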